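/- **Conventions.** For a nonzero polynomial $f$, write $f^*(x)=x^{\deg f}f(x^{-1})$; $f$ is self-reciprocal if $f=f^*$. If $f(0)\neq 0$, $\operatorname{ord}(f)$ is the least integer $e\ge 1$ with $f\mid x^e-1$. For $g\mid x^m-1$ in $\mathbb F_2[x]$, $\langle g\rangle$ is the binary cyclic code of length $m$ with generator polynomial $g$, i.e. all words $c\in\mathbb F_2^m$ with $g(x)\mid\sum_i c_ix^i$. An $(a_l,a_r)$-$[[N,k]]_2$ *quantum synchronizable code* (QSC) that corrects up to $t_p$ phase errors and up to $t_b$ bit errors is a $2^k$-dimensional space $Q$ of states of a block of $N$ qubits such that (a) for a block in a state of $Q$ that has suffered at most $t_p$ phase flips and at most $t_b$ bit flips and sits in a longer stream of qubits (the neighbouring qubits being in an arbitrary state), there is a projective measurement, performed on the window of $N$ consecutive qubits that the receiver takes for the block, which identifies with certainty by how many positions this window is misaligned, for all misalignments by up to $a_l$ qubits to the left and up to $a_r$ qubits to the right, and which does not disturb the state of the stream; and (b) one recovery channel on the realigned block restores every state of $Q$ from each such error. **Theorem.** Let $m>1$ be an odd integer all of whose prime factors $p$ satisfy $p\equiv -1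 \pmod 8$. Let $\alpha$ be a primitive $m$-th root of unity in an extension field of $\mathbb F_2$ and let $M_i(x)$ be the minimal polynomial of $\alpha^i$ over $\mathbb F_2$. Let $i_1,\dots,i_s$ be distinct indices such that $$x^m-1=(x-1)\,M_{i_1}(x)M_{i_1}^*(x)\cdots M_{i_s}(x)M_{i_s}^*(x),$$ where no $M_{i_j}$ is self-reciprocal. Let $T'\subseteq T\subseteq\{i_1,\dots,i_s\}$, and let $n=\operatorname{ord}(h)$ with $h(x)=\prod_{i\in T\setminus T'}M_i(x)$. Let $d_1$ be the minimum distance of $C=\langle\prod_{i\in T}M_i\rangle$ and $d_2$ the minimum distance of $D=\langle\prod_{i\in T'}M_i\rangle$. Then $n\mid m$, $d_2\le d_1$, the integer $k=m-2\sum_{i\in T}\deg M_i$ is nonnegative, and for every pair of nonnegative integers $(a_l,a_r)$ with $a_l+a_r<n$ there exists an $(a_l,a_r)$-$[[m+a_l+a_r,\;m-2\sum_{i\in T}\deg M_i]]_2$ QSC that corrects up to at least $\lfloor\frac{d_1-1}{2}\rfloor$ phase errors and up to at least $\lfloor\frac{d_2-1}{2}\rfloor$ bit errors. Moreover, if the greatest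 common divisor of $m$ and all the elements of $T$ is $1$, then $\lfloor\frac{d_1-1}{2}\rfloor\ge 1$, and if the greatest common divisor of $m$ and all the elements of $T'$ is $1$, then $\lfloor\frac{d_2-1}{2}\rfloor\ge 1$ (so that, by $d_2\le d_1$, the code then corrects at least one phase error and at least one bit error). An empty set of indices contributes nothing to these greatest common divisors, which are then equal to $m$. -/

import Mathlib

open Polynomial

/-! ### Classical binary cyclic codes -/

/-- The polynomial `c₀ + c₁ X + ⋯ + c_{m-1} X^{m-1}` of a binary word of length `m`. -/
noncomputable def wordPoly {m : ℕ} (c : Fin m → ZMod 2) : (ZMod 2)[X] :=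
  ∑ i : Fin m, C (c i) * X ^ (i : ℕ)

/-- The binary cyclic code of length `m` with generator polynomial `g`, where `g ∣ X ^ m - 1`:
the words whose polynomial is a multiple of `g`. -/
noncomputable def cyclicCode (m : ℕ) (g : (ZMod 2)[X]) : Submodule (ZMod 2) (Fin m → ZMod 2) where
  carrier := {c | g ∣ wordPoly c}
  add_mem' := by
    intro a b ha hb
    have h : wordPoly (a + b) = wordPoly a + wordPoly b := by
      simp [wordPoly, add_mul, Finset.sum_add_distrib]
    simp only [Set.mem_ofPred_eq] at ha hb ⊢
    rw [h]
    exact dvd_add ha hb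
  zero_mem' := by simp [wordPoly]
  smul_mem' := by
    intro r a ha
    have h : wordPoly (r • a) = C r * wordPoly a := by
      simp [wordPoly, Finset.mul_sum, mul_assoc]
    simp only [Set.mem_ofPred_eq] at ha ⊢
    rw [h]
    exact ha.mul_left _

/-- The minimum Hamming distance between distinct codewords (of a code with at least two words). -/
noncomputable def minDist {m : ℕ} (C : Submodule (ZMod 2) (Fin m → ZMod 2)) : ℕ :=
  sInf {d | ∃ x ∈ C, ∃ y ∈ C, x ≠ y ∧ hammingDist x y = d}

/-- The order of a polynomial `f` with `f(0) ≠ 0`: the least `e > 0` with `f ∣ X ^ e - 1`. -/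
noncomputable def polyOrder (f : (ZMod 2)[X]) : ℕ :=
  sInf {e | 0 < e ∧ f ∣ X ^ e - 1}

/-! ### Qubits and Pauli errors -/

/-- State vectors of `N` qubits, given by their amplitudes in the computational basis. -/
abbrev QState (N : ℕ) : Type := (Fin N → ZMod 2) → ℂ

/-- Operators on `N` qubits, as matrices in the computational basis. -/
abbrev QOp (N : ℕ) : Type := Matrix (Fin N → ZMod 2) (Fin N → ZMod 2) ℂ

/-- The bit error `X^a`, `|y⟩ ↦ |y + a⟩`: a bit flip on each qubit `i` with `a i ≠ 0`. -/
noncomputable def bitError {N : ℕ} (a : Fin N → ZMod 2) : QOp N :=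
  Matrix.of fun x y => if x = y + a then 1 else 0

/-- The phase error `Z^b`, `|y⟩ ↦ (-1)^(b ⬝ y) |y⟩`: a phase flip on each qubit `i`
with `b i ≠ 0`. -/
noncomputable def phaseError {N : ℕ} (b : Fin N → ZMod 2) : QOp N :=
  Matrix.diagonal fun y => ∏ i, (-1 : ℂ) ^ (b i * y i).val

/-- The Pauli errors with at most `tp` phase errors and at most `tb` bit errors. -/
def IsPauliError {N : ℕ} (tp tb : ℕ) (E : QOp N) : Prop :=
  ∃ a b : Fin N → ZMod 2, hammingNorm a ≤ tb ∧ hammingNorm b ≤ tp ∧ E = bitError a * phaseError b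

/-- The code space `Q` corrects up to `tp` phase errors and up to `tb` bit errors: there is one
recovery channel (with Kraus operators `R i`) that restores every code state from each of these
errors. -/
def CorrectsErrors {N : ℕ} (tp tb : ℕ) (Q : Submodule ℂ (QState N)) : Prop :=
  ∃ (r : ℕ) (R : Fin r → QOp N), (∑ i, (R i).conjTranspose * R i = 1) ∧
    ∀ E : QOp N, IsPauliError tp tb E → ∀ ψ ∈ Q,
      ∑ i, Matrix.vecMulVec ((R i * E).mulVec ψ) (star ((R i * E).mulVec ψ)) =
        Matrix.vecMulVec ψ (star ψ)

/-! ### Misalignment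

A block of `N` qubits travels in a stream of qubits. The part of the stream that a receiver can see
when he is misaligned by at most `al` qubits to the left or at most `ar` qubits to the right consists
of `al` qubits that precede the block, the block itself, and `ar` qubits that follow it. -/

/-- The positions seen through a window of `N` consecutive qubits that starts at position `s` of the
segment. The window `s = al` is the properly aligned one (it is the block itself); the window
`s = al + j` is misaligned by `j` qubits to the right and `s = al - j` by `j` qubits to the left. -/
def window (al ar N : ℕ) (s : Fin (al + ar + 1)) (j : Fin N) : Fin (al + N + ar) :=
  ⟨s + j, by omega⟩

/-- The window that coincides with the block. -/
def aligned (al ar : ℕ) : Fin (al + ar + 1) := ⟨al, by omega⟩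

/-- The operator `A` applied to the qubits at the positions `w 0, …, w (N - 1)` (with `w` injective)
of a register of `L` qubits, tensored with the identity on the other qubits. Here
`Function.extend w y x` is the bit string `x` with the bits at the positions `w` replaced by `y`. -/
noncomputable def applyAt {L N : ℕ} (w : Fin N → Fin L) (A : QOp N) (Ψ : QState L) : QState L :=
  fun x => ∑ y : Fin N → ZMod 2, A (x ∘ w) y * Ψ (Function.extend w y x)

/-- The state `Ψ` of the register lies in `V ⊗ (all states of the other qubits)`, where `V` is a space
of states of the qubits at the positions `w`; the other qubits may be in any state and may be
entangled with those at `w`. -/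
def SupportedOn {L N : ℕ} (w : Fin N → Fin L) (V : Submodule ℂ (QState N)) (Ψ : QState L) : Prop :=
  ∀ x : Fin L → ZMod 2, (fun y => Ψ (Function.extend w y x)) ∈ V

/-- The code space `Q` allows one to identify misalignment by up to `al` qubits to the left and up to
`ar` qubits to the right, in the presence of up to `tp` phase errors and up to `tb` bit errors on the
block: there is a projective measurement `P` of the `N` qubits in the receiver's window, with one
outcome for each possible misalignment, which yields the true misalignment with certainty and leaves
the state of the whole stream (the encoded block and its neighbours) undisturbed, whatever the
neighbouring qubits are. -/
def IdentifiesMisalignment {N : ℕ} (al ar tp tb : ℕ) (Q : Submodule ℂ (QState N)) : Prop :=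
  ∃ P : Fin (al + ar + 1) → QOp N,
    (∀ s, (P s).IsHermitian) ∧ (∀ s, P s * P s = P s) ∧ (∀ s t, s ≠ t → P s * P t = 0) ∧
    (∑ s, P s = 1) ∧
    ∀ E : QOp N, IsPauliError tp tb E →
      ∀ Ψ : QState (al + N + ar),
        SupportedOn (window al ar N (aligned al ar)) (Q.map (Matrix.mulVecLin E)) Ψ →
          ∀ s, applyAt (window al ar N s) (P s) Ψ = Ψ

/-- `Q` is an `(al, ar)-[[N, k]]` quantum synchronizable code that corrects up to `tp` phase errors
and up to `tb` bit errors: a `2 ^ k`-dimensional space of states of `N` qubits such that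
misalignments of up to `al` qubits to the left and up to `ar` qubits to the right can be identified
without disturbing the quantum states, so that the receiver can realign, and such that the errors
can be corrected on the realigned block. -/
structure IsQSC {N : ℕ} (al ar k tp tb : ℕ) (Q : Submodule ℂ (QState N)) : Prop where
  finrank_eq : Module.finrank ℂ Q = 2 ^ k
  identifies : IdentifiesMisalignment al ar tp tb Q
  corrects : CorrectsErrors tp tb Q

/-! Write C and D for the codes generated by the products over `T` and `T'`, so C ⊆ D. Over the odd
length m the polynomial X^m - 1 is separable, so each α^{-i} with i in `T`, being a root of the
reciprocal of M_i, is not a root of the generator of C. Evaluating a word of C^⊥ against the shifts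
of that generator then gives C^⊥ ⊆ C (`dualCode_le_cyclicCode`).

Let w be the generator of D, read as a word. The code space consists of the states supported on the
periodic extensions of w + C to length m + al + ar and invariant under translation by the extended
C^⊥. Its dimension is |C| / |C^⊥| = 2^k, by the trace of its projection.

Errors: a string of the code is determined by its first m bits, so the minimum distance of C
separates bit errors. On such strings a phase error acts as its folding modulo m; two distinct light
foldings differ by a word outside C, so some word of C^⊥ flips their relative sign. The errors thus
send the code space to mutually orthogonal copies (`correctsErrors_of_orthogonal`).

Misalignment: by periodicity, the middle m bits of a window at offset s are a cyclic shift by s of a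
word in w + C, plus noise. Decoding in D removes the noise. For i in T \ T' the value at α^i sees
only w, is nonzero, and determines (α^i)^s, hence s modulo the order n
(`cyclicShift_eq_of_noisy_eq`). The measurement is diagonal in the computational basis, so phase
errors do not affect it and the state is not disturbed. -/

/-! ### Bit strings in characteristic two. -/

section Bits

variable {ι : Type*}

theorem eq_one_of_ne_zero_zmod_two (a : ZMod 2) (ha : a ≠ 0) : a = 1 := by
  revert a
  decide

theorem bits_add_self (a : ι → ZMod 2) : a + a = 0 := funext fun _ => CharTwo.add_self_eq_zero _

theorem bits_neg (a : ι → ZMod 2) : -a = a := funext fun _ => CharTwo.neg_eq _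

theorem bits_add_add_cancel (a b : ι → ZMod 2) : a + b + b = a := by
  rw [add_assoc, bits_add_self, add_zero]

theorem bits_eq_of_add_eq_zero {a b : ι → ZMod 2} (h : a + b = 0) : a = b := by
  rw [← bits_add_add_cancel a b, h, zero_add]

end Bits

/-! ### Words as polynomials: evaluation, cyclic shifts, dimension. -/

section Words

variable {m : ℕ} {L : Type*} [Field L] [Algebra (ZMod 2) L]

theorem mem_cyclicCode {g : (ZMod 2)[X]} {c : Fin m → ZMod 2} :
    c ∈ cyclicCode m g ↔ g ∣ wordPoly c := Iff.rfl

theorem aeval_wordPoly (ζ : L) (c : Fin m → ZMod 2) :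
    aeval ζ (wordPoly c) = ∑ i, algebraMap (ZMod 2) L (c i) * ζ ^ (i : ℕ) := by
  simp [wordPoly]

theorem wordPoly_add (a b : Fin m → ZMod 2) : wordPoly (a + b) = wordPoly a + wordPoly b := by
  simp [wordPoly, add_mul, Finset.sum_add_distrib]

theorem wordPoly_coeff {f : (ZMod 2)[X]} (hf : f.natDegree < m) :
    wordPoly (fun i : Fin m => f.coeff i) = f := by
  conv_rhs => rw [f.as_sum_range' m hf]
  rw [wordPoly, Fin.sum_univ_eq_sum_range (fun i => C (f.coeff i) * X ^ i)]
  simp [C_mul_X_pow_eq_monomial]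

/-- The word `c` shifted cyclically by `t` positions. -/
def cyclicShift (t : ℕ) (c : Fin m → ZMod 2) : Fin m → ZMod 2 :=
  fun i => c ⟨(t + i) % m, Nat.mod_lt _ i.pos⟩

theorem bijective_rotate (t : ℕ) :
    Function.Bijective fun i : Fin m => (⟨(t + i) % m, Nat.mod_lt _ i.pos⟩ : Fin m) := by
  refine Finite.injective_iff_bijective.mp fun i j h => ?_
  have h' : t + i ≡ t + j [MOD m] := congrArg Fin.val h
  have := Nat.ModEq.add_left_cancel' t h'
  exact Fin.ext (Nat.ModEq.eq_of_lt_of_lt this i.2 j.2)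

theorem pow_mul_aeval_cyclicShift {ζ : L} (hζ : ζ ^ m = 1) (t : ℕ) (c : Fin m → ZMod 2) :
    ζ ^ t * aeval ζ (wordPoly (cyclicShift t c)) = aeval ζ (wordPoly c) := by
  rw [aeval_wordPoly, aeval_wordPoly, Finset.mul_sum]
  refine Fintype.sum_bijective _ (bijective_rotate t) _ _ fun i => ?_
  have : ζ ^ ((t + i) % m) = ζ ^ (t + (i : ℕ)) := (pow_eq_pow_mod _ hζ).symm
  simp only [cyclicShift, this, pow_add]
  ring

/-- If `u` is orthogonal to all cyclic shifts of `v`, then the polynomials of `u` and `v` have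
vanishing product of values at mutually inverse `m`-th roots of unity. -/
theorem aeval_mul_aeval_inv_eq_zero {ζ : L} (hζ : ζ ^ m = 1) (hm : m ≠ 0) {u v : Fin m → ZMod 2}
    (h : ∀ t, u ⬝ᵥ cyclicShift t v = 0) :
    aeval ζ (wordPoly u) * aeval ζ⁻¹ (wordPoly v) = 0 := by
  have hζ0 : ζ ≠ 0 := by
    rintro rfl
    simp [hm] at hζ
  have hη : ζ⁻¹ ^ m = 1 := by simp [hζ]
  have key : ∀ i : Fin m, ζ ^ (i : ℕ) * aeval ζ⁻¹ (wordPoly v) =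
      aeval ζ⁻¹ (wordPoly (cyclicShift i v)) := by
    intro i
    rw [← pow_mul_aeval_cyclicShift hη i v, ← mul_assoc, ← mul_pow, mul_inv_cancel₀ hζ0, one_pow,
      one_mul]
  rw [aeval_wordPoly, Finset.sum_mul]
  -- The product expands to the sum over t of ζ^{-t} times the inner product of u with the shift of
  -- v by t.
  simp_rw [mul_assoc, key, aeval_wordPoly, Finset.mul_sum]
  rw [Finset.sum_comm]
  refine Finset.sum_eq_zero fun t _ => ?_
  have ht := congrArg (fun z => algebraMap (ZMod 2) L z * ζ⁻¹ ^ (t : ℕ)) (h t)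
  simp only [dotProduct, map_sum, map_mul, map_zero, zero_mul, Finset.sum_mul] at ht
  rw [← ht]
  refine Finset.sum_congr rfl fun i _ => ?_
  simp only [cyclicShift, add_comm (t : ℕ) (i : ℕ), mul_assoc]

/-- The map sending a word to the residue class of its polynomial. -/
noncomputable def wordResidue (m : ℕ) (g : (ZMod 2)[X]) :
    (Fin m → ZMod 2) →ₗ[ZMod 2] AdjoinRoot g where
  toFun c := AdjoinRoot.mk g (wordPoly c)
  map_add' a b := by rw [wordPoly_add, map_add]
  map_smul' r a := by
    have h : wordPoly (r • a) = r • wordPoly a := by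
      simp [wordPoly, Finset.smul_sum, smul_eq_C_mul, mul_assoc]
    rw [h, ← AdjoinRoot.smul_mk, RingHom.id_apply]

/-- Rank-nullity for reduction modulo g: the code is the kernel, and remainders modulo g fit into m
coefficients, so the map is onto. -/
theorem finrank_cyclicCode {g : (ZMod 2)[X]} (hg : g.Monic) (hgm : g.natDegree ≤ m) :
    Module.finrank (ZMod 2) (cyclicCode m g) + g.natDegree = m := by
  have hker : LinearMap.ker (wordResidue m g) = cyclicCode m g := by
    ext c
    simp [wordResidue, mem_cyclicCode, AdjoinRoot.mk_eq_zero]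
  have hsurj : Function.Surjective (wordResidue m g) := by
    intro z
    obtain ⟨p, rfl⟩ := AdjoinRoot.mk_surjective z
    -- For g = 1 remainders have no smaller degree than g, but the quotient ring is trivial.
    by_cases h1 : g = 1
    · refine ⟨0, ?_⟩
      rw [map_zero, eq_comm, AdjoinRoot.mk_eq_zero, h1]
      exact one_dvd p
    · refine ⟨fun i => (p %ₘ g).coeff i, ?_⟩
      have hd : (p %ₘ g).natDegree < m := (natDegree_modByMonic_lt p hg h1).trans_le hgm
      change AdjoinRoot.mk g (wordPoly _) = _
      rw [wordPoly_coeff hd, AdjoinRoot.mk_eq_mk]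
      refine ⟨-(p /ₘ g), ?_⟩
      have := modByMonic_add_div p g
      linear_combination this
  have h := (wordResidue m g).finrank_range_add_finrank_ker
  rw [LinearMap.range_eq_top.mpr hsurj, finrank_top, hker, Module.finrank_fin_fun,
    (AdjoinRoot.powerBasis' hg).finrank, AdjoinRoot.powerBasis'_dim] at h
  omega

theorem natCard_eq_two_pow (W : Submodule (ZMod 2) (Fin m → ZMod 2)) :
    Nat.card W = 2 ^ Module.finrank (ZMod 2) W := by
  rw [Module.natCard_eq_pow_finrank (K := ZMod 2), Nat.card_zmod]

end Words

/-! ### Dual codes with respect to the dot product. -/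

section Dual

variable {m : ℕ}

/-- The dual code. -/
def dualCode (W : Submodule (ZMod 2) (Fin m → ZMod 2)) : Submodule (ZMod 2) (Fin m → ZMod 2) :=
  LinearMap.BilinForm.orthogonal (dotProductBilin (ZMod 2) (ZMod 2)) W

theorem mem_dualCode {W : Submodule (ZMod 2) (Fin m → ZMod 2)} {u : Fin m → ZMod 2} :
    u ∈ dualCode W ↔ ∀ c ∈ W, u ⬝ᵥ c = 0 := by
  simp only [dualCode, LinearMap.BilinForm.mem_orthogonal_iff]
  exact forall₂_congr fun c _ => by rw [dotProduct_comm]; rfl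

theorem dotProductBilin_nondegenerate :
    LinearMap.BilinForm.Nondegenerate
      (dotProductBilin (ZMod 2) (ZMod 2) : LinearMap.BilinForm (ZMod 2) (Fin m → ZMod 2)) := by
  refine ⟨fun u hu => dotProduct_eq_zero u fun v => hu v,
    fun u hu => dotProduct_eq_zero u fun v => ?_⟩
  rw [dotProduct_comm]
  exact hu v

theorem finrank_dualCode (W : Submodule (ZMod 2) (Fin m → ZMod 2)) :
    Module.finrank (ZMod 2) (dualCode W) + Module.finrank (ZMod 2) W = m := by
  have h := LinearMap.BilinForm.finrank_orthogonal dotProductBilin_nondegenerate W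
  have h2 := Submodule.finrank_le W
  rw [Module.finrank_fin_fun] at h h2
  unfold dualCode
  omega

theorem dualCode_dualCode (W : Submodule (ZMod 2) (Fin m → ZMod 2)) : dualCode (dualCode W) = W :=
  LinearMap.BilinForm.orthogonal_orthogonal dotProductBilin_nondegenerate
    (fun u v h => by rw [← h]; exact dotProduct_comm v u) W

/-- A word outside the code fails to be orthogonal to some dual word. -/
theorem exists_dotProduct_eq_one {W : Submodule (ZMod 2) (Fin m → ZMod 2)} {b : Fin m → ZMod 2}
    (hb : b ∉ W) : ∃ u ∈ dualCode W, b ⬝ᵥ u = 1 := by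
  rw [← dualCode_dualCode W, mem_dualCode] at hb
  push Not at hb
  obtain ⟨u, hu, h⟩ := hb
  exact ⟨u, hu, (eq_one_of_ne_zero_zmod_two _ h)⟩

end Dual

/-! ### Minimum distance and unique decoding. -/

section MinDist

variable {m : ℕ}

theorem minDist_le {W : Submodule (ZMod 2) (Fin m → ZMod 2)} {x y : Fin m → ZMod 2} (hx : x ∈ W)
    (hy : y ∈ W) (hxy : x ≠ y) : minDist W ≤ hammingDist x y :=
  Nat.sInf_le ⟨x, hx, y, hy, hxy, rfl⟩

theorem le_minDist {W : Submodule (ZMod 2) (Fin m → ZMod 2)} (hW : W ≠ ⊥) {d : ℕ}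
    (h : ∀ c ∈ W, c ≠ 0 → d ≤ hammingNorm c) : d ≤ minDist W := by
  obtain ⟨c, hc, hc0⟩ := W.ne_bot_iff.mp hW
  refine le_csInf ⟨_, c, hc, 0, W.zero_mem, hc0, rfl⟩ ?_
  rintro _ ⟨x, hx, y, hy, hxy, rfl⟩
  rw [hammingDist_eq_hammingNorm]
  exact h _ (W.add_mem (W.neg_mem hx) hy) fun h0 => hxy (neg_add_eq_zero.mp h0)

theorem minDist_antitone {W W' : Submodule (ZMod 2) (Fin m → ZMod 2)} (hW : W ≠ ⊥) (h : W ≤ W') :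
    minDist W' ≤ minDist W := by
  refine le_minDist hW fun c hc hc0 => ?_
  rw [← hammingDist_zero_right]
  exact minDist_le (h hc) W'.zero_mem hc0

theorem hammingNorm_add_le (a b : Fin m → ZMod 2) :
    hammingNorm (a + b) ≤ hammingNorm a + hammingNorm b := by
  have := hammingDist_triangle a 0 b
  rwa [hammingDist_zero_right, hammingDist_zero_left, hammingDist_eq_hammingNorm, bits_neg] at this

/-- Words at distance at most half the minimum distance from a common word coincide. -/
theorem eq_of_add_eq_add {W : Submodule (ZMod 2) (Fin m → ZMod 2)} {d : ℕ} (hd : d ≤ minDist W)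
    {x y a b : Fin m → ZMod 2} (hxy : x + y ∈ W)
    (ha : hammingNorm a ≤ (d - 1) / 2) (hb : hammingNorm b ≤ (d - 1) / 2) (h : x + a = y + b) :
    x = y := by
  by_contra hne
  have hab : x + y = a + b := by
    have : x + y = (x + a) + (y + a) := by
      rw [add_add_add_comm, bits_add_self, add_zero]
    rw [this, h, add_comm y a, add_comm y b, add_add_add_comm, bits_add_self, add_zero, add_comm]
  have hne0 : x + y ≠ 0 := fun h0 => hne (bits_eq_of_add_eq_zero h0)
  have h1 := hd.trans (minDist_le hxy W.zero_mem hne0)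
  rw [hammingDist_zero_right] at h1
  have h2 := hammingNorm_add_le a b
  rw [← hab] at h2
  -- Needed when d = 0, where d - 1 truncates to 0 and h1 says nothing.
  have h3 : hammingNorm (x + y) ≠ 0 := hammingNorm_ne_zero_iff.mpr hne0
  omega

theorem add_mem_of_hammingNorm_le {W : Submodule (ZMod 2) (Fin m → ZMod 2)} {d : ℕ}
    (hd : d ≤ minDist W) {a b : Fin m → ZMod 2} (ha : hammingNorm a ≤ (d - 1) / 2)
    (hb : hammingNorm b ≤ (d - 1) / 2) (h : a + b ∈ W) : a = b :=
  eq_of_add_eq_add hd h hb ha (add_comm a b)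

end MinDist

/-! ### Cyclic codes through their roots; orders; the bound d ≥ 3. -/

section Roots

variable {m : ℕ} {L : Type*} [Field L] [Algebra (ZMod 2) L] {α : L} {M : ℕ → (ZMod 2)[X]}
  {I T T' : Finset ℕ}

/-- For odd m the polynomial X^m - 1 is separable over the field of two elements, so its factors do
not repeat. -/
theorem isCoprime_of_mul_dvd {f g : (ZMod 2)[X]} (hm : Odd m) (h : f * g ∣ X ^ m - 1) :
    IsCoprime f g := by
  refine Separable.isCoprime (Separable.of_dvd (X_pow_sub_one_separable_iff.mpr ?_) h)
  rw [ZMod.natCast_ne_zero_iff_odd]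
  exact hm

theorem aeval_ne_zero_of_isCoprime {f g : (ZMod 2)[X]} (h : IsCoprime f g) {ζ : L}
    (hf : aeval ζ f = 0) : aeval ζ g ≠ 0 := by
  intro hg
  obtain ⟨a, b, hab⟩ := h
  have := congrArg (aeval ζ) hab
  simp [hf, hg] at this

theorem prod_mul_prod_reverse_dvd
    (hfac : X ^ m - 1 = (X - 1) * ∏ i ∈ I, (M i * (M i).reverse)) (hT : T ⊆ I) :
    (∏ i ∈ T, M i) * ∏ i ∈ T, (M i).reverse ∣ X ^ m - 1 := by
  rw [hfac, ← Finset.prod_mul_distrib]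
  exact (Finset.prod_dvd_prod_of_subset _ _ _ hT).mul_left _

theorem pairwise_isCoprime (hm : Odd m)
    (hfac : X ^ m - 1 = (X - 1) * ∏ i ∈ I, (M i * (M i).reverse)) {i j : ℕ} (hi : i ∈ I)
    (hj : j ∈ I) (hij : i ≠ j) : IsCoprime (M i) (M j) := by
  refine isCoprime_of_mul_dvd hm ?_
  have h : ({i, j} : Finset ℕ) ⊆ I := by
    intro x hx
    rcases Finset.mem_insert.mp hx with rfl | hx
    · exact hi
    · rwa [Finset.mem_singleton.mp hx]
  have := dvd_of_mul_right_dvd (prod_mul_prod_reverse_dvd hfac h)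
  rwa [Finset.prod_pair hij] at this

theorem prod_minpoly_dvd_iff (hm : Odd m) (hM : ∀ i, M i = minpoly (ZMod 2) (α ^ i))
    (hfac : X ^ m - 1 = (X - 1) * ∏ i ∈ I, (M i * (M i).reverse)) (hT : T ⊆ I)
    (f : (ZMod 2)[X]) : ∏ i ∈ T, M i ∣ f ↔ ∀ i ∈ T, aeval (α ^ i) f = 0 := by
  constructor
  · intro h i hi
    have := (Finset.dvd_prod_of_mem M hi).trans h
    rw [hM] at this
    exact (aeval_eq_zero_of_dvd_aeval_eq_zero this (minpoly.aeval _ _))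
  · intro h
    refine Finset.prod_dvd_of_coprime (fun i hi j hj hij => ?_) fun i hi => ?_
    · exact pairwise_isCoprime hm hfac (hT hi) (hT hj) hij
    · rw [hM]
      exact minpoly.dvd _ _ (h i hi)

theorem mem_cyclicCode_prod (hm : Odd m) (hM : ∀ i, M i = minpoly (ZMod 2) (α ^ i))
    (hfac : X ^ m - 1 = (X - 1) * ∏ i ∈ I, (M i * (M i).reverse)) (hT : T ⊆ I)
    {c : Fin m → ZMod 2} :
    c ∈ cyclicCode m (∏ i ∈ T, M i) ↔ ∀ i ∈ T, aeval (α ^ i) (wordPoly c) = 0 :=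
  prod_minpoly_dvd_iff hm hM hfac hT _

/-- The factor X - 1 is left over, which makes the inequality strict and lets the generator be read
as a word of length m. -/
theorem natDegree_prod_lt (hm : Odd m)
    (hfac : X ^ m - 1 = (X - 1) * ∏ i ∈ I, (M i * (M i).reverse)) (hT : T ⊆ I) :
    (∏ i ∈ T, M i).natDegree < m := by
  have hd : (X - 1) * (∏ i ∈ T, M i) ∣ X ^ m - 1 := by
    rw [hfac]
    refine mul_dvd_mul_left _ ((Finset.prod_dvd_prod_of_subset _ _ _ hT).trans ?_)
    exact Finset.prod_dvd_prod_of_dvd _ _ fun i _ => dvd_mul_right _ _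
  have h0 : (X ^ m - 1 : (ZMod 2)[X]) ≠ 0 := X_pow_sub_C_ne_zero hm.pos 1
  have hle := natDegree_le_of_dvd hd h0
  have h1 : (X - 1 : (ZMod 2)[X]) ≠ 0 := X_sub_C_ne_zero 1
  have h2 : (∏ i ∈ T, M i) ≠ 0 := by
    rintro h
    rw [h, mul_zero, zero_dvd_iff] at hd
    exact h0 hd
  have e1 : (X - 1 : (ZMod 2)[X]).natDegree = 1 := natDegree_X_sub_C 1
  have e2 : (X ^ m - 1 : (ZMod 2)[X]).natDegree = m := natDegree_X_pow_sub_C (r := 1)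
  rw [natDegree_mul h1 h2, e1, e2] at hle
  omega

/-- The minimal polynomial of 1 is X + 1, which is self-reciprocal. -/
theorem pow_ne_one_of_ne_reverse (hM : ∀ i, M i = minpoly (ZMod 2) (α ^ i)) {i : ℕ}
    (hi : M i ≠ (M i).reverse) : α ^ i ≠ 1 := by
  intro h
  apply hi
  have : M i = X + C 1 := by
    rw [hM, h, minpoly.one, C_1, ← CharTwo.sub_eq_add]
  rw [this, reverse, natDegree_X_add_C, reflect_add, reflect_C, pow_one, C_1, one_mul, add_comm]
  congr 1
  simp

/-- The geometric sum vanishes at every m-th root of unity other than 1. This shows the code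
nonzero, so that `minDist` is not the infimum of an empty set. -/
theorem one_mem_cyclicCode (hm : Odd m) (hα : IsPrimitiveRoot α m)
    (hM : ∀ i, M i = minpoly (ZMod 2) (α ^ i)) (hI : ∀ i ∈ I, M i ≠ (M i).reverse)
    (hfac : X ^ m - 1 = (X - 1) * ∏ i ∈ I, (M i * (M i).reverse)) (hT : T ⊆ I) :
    (1 : Fin m → ZMod 2) ∈ cyclicCode m (∏ i ∈ T, M i) := by
  rw [mem_cyclicCode_prod hm hM hfac hT]
  intro i hi
  have hne := pow_ne_one_of_ne_reverse hM (hI i (hT hi))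
  have hs := mul_geom_sum (α ^ i) m
  rw [← pow_mul, mul_comm i, pow_mul, hα.pow_eq_one, one_pow, sub_self, mul_eq_zero] at hs
  rw [aeval_wordPoly]
  simp only [Pi.one_apply, map_one, one_mul]
  rw [Fin.sum_univ_eq_sum_range (fun k => (α ^ i) ^ k)]
  exact hs.resolve_left (sub_ne_zero.mpr hne)

theorem cyclicCode_prod_ne_bot (hm : Odd m) (hα : IsPrimitiveRoot α m)
    (hM : ∀ i, M i = minpoly (ZMod 2) (α ^ i)) (hI : ∀ i ∈ I, M i ≠ (M i).reverse)
    (hfac : X ^ m - 1 = (X - 1) * ∏ i ∈ I, (M i * (M i).reverse)) (hT : T ⊆ I) :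
    cyclicCode m (∏ i ∈ T, M i) ≠ ⊥ := by
  intro h
  have h1 := one_mem_cyclicCode hm hα hM hI hfac hT
  rw [h, Submodule.mem_bot] at h1
  have := congrFun h1 ⟨0, hm.pos⟩
  simp at this

theorem root_pow_eq_one {L : Type*} [Field L] {α : L} (hα : IsPrimitiveRoot α m) (i : ℕ) :
    (α ^ i) ^ m = 1 := by
  rw [← pow_mul, mul_comm, pow_mul, hα.pow_eq_one, one_pow]

theorem cyclicShift_mem (hm : Odd m) (hα : IsPrimitiveRoot α m)
    (hM : ∀ i, M i = minpoly (ZMod 2) (α ^ i))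
    (hfac : X ^ m - 1 = (X - 1) * ∏ i ∈ I, (M i * (M i).reverse)) (hT : T ⊆ I)
    {c : Fin m → ZMod 2} (hc : c ∈ cyclicCode m (∏ i ∈ T, M i)) (t : ℕ) :
    cyclicShift t c ∈ cyclicCode m (∏ i ∈ T, M i) := by
  rw [mem_cyclicCode_prod hm hM hfac hT] at hc ⊢
  intro i hi
  have h := pow_mul_aeval_cyclicShift (root_pow_eq_one hα i) t c
  rw [hc i hi, mul_eq_zero] at h
  refine h.resolve_left (pow_ne_zero _ (pow_ne_zero _ (hα.ne_zero hm.pos.ne')))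

/-- A dual word u is orthogonal to all shifts of the generator g, so u(α^i) g(α^{-i}) = 0; the
second factor is nonzero because g is coprime to the reciprocal product. -/
theorem dualCode_le_cyclicCode (hm : Odd m) (hα : IsPrimitiveRoot α m)
    (hM : ∀ i, M i = minpoly (ZMod 2) (α ^ i))
    (hfac : X ^ m - 1 = (X - 1) * ∏ i ∈ I, (M i * (M i).reverse)) (hT : T ⊆ I) :
    dualCode (cyclicCode m (∏ i ∈ T, M i)) ≤ cyclicCode m (∏ i ∈ T, M i) := by
  intro u hu
  rw [mem_dualCode] at hu
  rw [mem_cyclicCode_prod hm hM hfac hT]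
  intro i hi
  have hw := wordPoly_coeff (natDegree_prod_lt hm hfac hT)
  have hmem : (fun j : Fin m => (∏ i ∈ T, M i).coeff j) ∈ cyclicCode m (∏ i ∈ T, M i) := by
    rw [mem_cyclicCode, hw]
  have h := aeval_mul_aeval_inv_eq_zero (root_pow_eq_one hα i) hm.pos.ne'
    fun t => hu _ (cyclicShift_mem hm hα hM hfac hT hmem t)
  rw [hw, mul_eq_zero] at h
  refine h.resolve_right ?_
  have hcop := isCoprime_of_mul_dvd hm (prod_mul_prod_reverse_dvd hfac hT)
  refine aeval_ne_zero_of_isCoprime hcop.symm ?_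
  have h0 : aeval (α ^ i)⁻¹ (M i).reverse = 0 := by
    let := invertibleOfNonzero (pow_ne_zero i (hα.ne_zero hm.pos.ne'))
    rw [← invOf_eq_inv, aeval_def, eval₂_reverse_eq_zero_iff, hM, ← aeval_def, minpoly.aeval]
  rw [map_prod]
  exact Finset.prod_eq_zero hi h0

theorem aeval_prod_ne_zero (hm : Odd m) (hM : ∀ i, M i = minpoly (ZMod 2) (α ^ i))
    (hfac : X ^ m - 1 = (X - 1) * ∏ i ∈ I, (M i * (M i).reverse)) (hT' : T' ⊆ T) (hT : T ⊆ I)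
    {i : ℕ} (hi : i ∈ T \ T') : aeval (α ^ i) (∏ j ∈ T', M j) ≠ 0 := by
  rw [Finset.mem_sdiff] at hi
  rw [map_prod, Finset.prod_ne_zero_iff]
  intro j hj
  refine aeval_ne_zero_of_isCoprime (pairwise_isCoprime hm hfac (hT hi.1) (hT (hT' hj)) ?_) ?_
  · rintro rfl
    exact hi.2 hj
  · rw [hM, minpoly.aeval]

theorem dvd_X_pow_sub_one_iff (hm : Odd m) (hM : ∀ i, M i = minpoly (ZMod 2) (α ^ i))
    (hfac : X ^ m - 1 = (X - 1) * ∏ i ∈ I, (M i * (M i).reverse)) (hT : T ⊆ I) (e : ℕ) :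
    ∏ i ∈ T, M i ∣ X ^ e - 1 ↔ ∀ i ∈ T, (α ^ i) ^ e = 1 := by
  rw [prod_minpoly_dvd_iff hm hM hfac hT]
  simp [sub_eq_zero]

theorem polyOrder_pos_and_dvd (hm : Odd m)
    (hfac : X ^ m - 1 = (X - 1) * ∏ i ∈ I, (M i * (M i).reverse)) (hT : T ⊆ I) :
    0 < polyOrder (∏ i ∈ T, M i) ∧ ∏ i ∈ T, M i ∣ X ^ polyOrder (∏ i ∈ T, M i) - 1 :=
  Nat.sInf_mem (s := {e | 0 < e ∧ ∏ i ∈ T, M i ∣ X ^ e - 1})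
    ⟨m, hm.pos, dvd_of_mul_right_dvd (prod_mul_prod_reverse_dvd hfac hT)⟩

theorem polyOrder_dvd (hm : Odd m) (hM : ∀ i, M i = minpoly (ZMod 2) (α ^ i))
    (hfac : X ^ m - 1 = (X - 1) * ∏ i ∈ I, (M i * (M i).reverse)) (hT : T ⊆ I) {e : ℕ}
    (he : ∀ i ∈ T, (α ^ i) ^ e = 1) : polyOrder (∏ i ∈ T, M i) ∣ e := by
  obtain ⟨hpos, hdvd⟩ := polyOrder_pos_and_dvd hm hfac hT
  rw [dvd_X_pow_sub_one_iff hm hM hfac hT] at hdvd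
  by_contra hne
  have hr : 0 < e % polyOrder (∏ i ∈ T, M i) :=
    Nat.pos_of_ne_zero fun h => hne (Nat.dvd_of_mod_eq_zero h)
  have hmem : polyOrder (∏ i ∈ T, M i) ≤ e % polyOrder (∏ i ∈ T, M i) := by
    refine Nat.sInf_le ⟨hr, ?_⟩
    rw [dvd_X_pow_sub_one_iff hm hM hfac hT]
    intro i hi
    rw [← pow_eq_pow_mod e (hdvd i hi), he i hi]
  exact absurd (Nat.mod_lt e hpos) (not_lt.mpr hmem)

theorem three_le_minDist (hm1 : m ≠ 1) (hm : Odd m) (hα : IsPrimitiveRoot α m)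
    (hM : ∀ i, M i = minpoly (ZMod 2) (α ^ i)) (hI : ∀ i ∈ I, M i ≠ (M i).reverse)
    (hfac : X ^ m - 1 = (X - 1) * ∏ i ∈ I, (M i * (M i).reverse)) (hT : T ⊆ I)
    (hgcd : Nat.gcd m (T.gcd id) = 1) : 3 ≤ minDist (cyclicCode m (∏ i ∈ T, M i)) := by
  refine le_minDist (cyclicCode_prod_ne_bot hm hα hM hI hfac hT) fun c hc hc0 => ?_
  rw [mem_cyclicCode_prod hm hM hfac hT] at hc
  have hα0 : α ≠ 0 := hα.ne_zero hm.pos.ne'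
  have hsum : ∀ i ∈ T, ∑ j with c j ≠ 0, (α ^ i) ^ (j : ℕ) = 0 := by
    intro i hi
    rw [← hc i hi, aeval_wordPoly, Finset.sum_filter]
    refine Finset.sum_congr rfl fun j _ => ?_
    split_ifs with hj
    · rw [eq_one_of_ne_zero_zmod_two _ hj, map_one, one_mul]
    · rw [not_not.mp hj, map_zero, zero_mul]
  have hTne : T.Nonempty := by
    rw [Finset.nonempty_iff_ne_empty]
    rintro rfl
    simp at hgcd
    exact hm1 hgcd
  by_contra hlt
  have hpos : hammingNorm c ≠ 0 := hammingNorm_ne_zero_iff.mpr hc0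
  have hcases : hammingNorm c = 1 ∨ hammingNorm c = 2 := by omega
  rw [hammingNorm] at hcases
  rcases hcases with h | h
  · obtain ⟨a, ha⟩ := Finset.card_eq_one.mp h
    obtain ⟨i, hi⟩ := hTne
    have := hsum i hi
    rw [ha, Finset.sum_singleton] at this
    exact pow_ne_zero _ (pow_ne_zero _ hα0) this
  · obtain ⟨a, b, hab, hs⟩ := Finset.card_eq_two.mp h
    have h2 : ∀ i ∈ T, i * (a : ℕ) ≡ i * b [MOD m] := by
      intro i hi
      have := hsum i hi
      -- In characteristic two a vanishing sum of two powers is an equality of powers, hence a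
      -- congruence of exponents modulo m.
      have hch : CharP L 2 := charP_of_injective_algebraMap (algebraMap (ZMod 2) L).injective 2
      rw [hs, Finset.sum_pair hab, CharTwo.add_eq_zero, ← pow_mul, ← pow_mul] at this
      have hfin : IsOfFinOrder α := isOfFinOrder_iff_pow_eq_one.mpr ⟨m, hm.pos, hα.pow_eq_one⟩
      have h := hfin.pow_eq_pow_iff_modEq.mp this
      rwa [← hα.eq_orderOf] at h
    -- m divides i (b - a) for every i in `T`, and trivially m (b - a), hence the gcd of all these
    -- multiples.
    have h3 : (m : ℤ) ∣ Nat.gcd m (T.gcd id) * ((b : ℤ) - a) := by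
      have hz : ∀ i ∈ T, m ∣ i * ((b : ℤ) - a).natAbs := by
        intro i hi
        have := (Nat.modEq_iff_dvd.mp (h2 i hi))
        push_cast at this
        rw [← mul_sub] at this
        have := Int.natAbs_dvd_natAbs.mpr this
        simpa [Int.natAbs_mul] using this
      have h4 : m ∣ T.gcd id * ((b : ℤ) - a).natAbs := by
        have : T.gcd (fun i => id i * ((b : ℤ) - a).natAbs) = T.gcd id * ((b : ℤ) - a).natAbs := by
          rw [Finset.gcd_mul_right]
          simp
        rw [← this]
        exact Finset.dvd_gcd hz
      have h5 := Nat.dvd_gcd (dvd_mul_right m ((b : ℤ) - a).natAbs) h4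
      rw [Nat.gcd_mul_right] at h5
      rw [← Int.natAbs_dvd_natAbs]
      simpa [Int.natAbs_mul] using h5
    rw [hgcd, Nat.cast_one, one_mul] at h3
    exact hab (Fin.ext (Nat.ModEq.eq_of_lt_of_lt (Nat.modEq_iff_dvd.mpr h3) a.2 b.2))

end Roots

/-! ### Signs and Pauli operators. -/

section Sign

/-- The nontrivial character of `ZMod 2`. -/
noncomputable def signChar : AddChar (ZMod 2) ℂ where
  toFun a := (-1) ^ a.val
  map_zero_eq_one' := by simp
  map_add_eq_mul' a b := by
    rw [← pow_add, ZMod.val_add, neg_one_pow_eq_pow_mod_two, neg_one_pow_eq_pow_mod_two (n := _ + _),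
      Nat.mod_mod]

theorem signChar_apply (a : ZMod 2) : signChar a = (-1) ^ a.val := rfl

theorem signChar_one : signChar 1 = -1 := by
  rw [signChar_apply, ZMod.val_one, pow_one]

theorem signChar_mul_self (a : ZMod 2) : signChar a * signChar a = 1 := by
  rw [← AddChar.map_add_eq_mul, CharTwo.add_self_eq_zero, AddChar.map_zero_eq_one]

theorem star_signChar (a : ZMod 2) : star (signChar a) = signChar a := by
  rw [signChar_apply, star_pow, star_neg, star_one]

theorem phaseError_eq {N : ℕ} (b : Fin N → ZMod 2) :
    phaseError b = Matrix.diagonal fun y => signChar (b ⬝ᵥ y) := by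
  have h : ∀ y : Fin N → ZMod 2, signChar (b ⬝ᵥ y) = ∏ i, (-1 : ℂ) ^ (b i * y i).val := by
    intro y
    have := map_prod signChar.toMonoidHom (fun i => Multiplicative.ofAdd (b i * y i)) Finset.univ
    rw [← ofAdd_sum] at this
    exact this
  simp only [h, phaseError]

end Sign

section ErrorOperators

variable {N : ℕ}

theorem bitError_apply (a x y : Fin N → ZMod 2) :
    bitError a x y = if x = y + a then 1 else 0 := rfl

theorem bitError_conjTranspose (a : Fin N → ZMod 2) : (bitError a).conjTranspose = bitError a := by
  ext x y
  rw [Matrix.conjTranspose_apply, bitError_apply, bitError_apply]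
  have h : y = x + a ↔ x = y + a := by
    constructor <;> rintro rfl <;> rw [bits_add_add_cancel]
  simp only [h]
  split_ifs <;> simp

theorem bitError_mul (a : Fin N → ZMod 2) (A : QOp N) (x y : Fin N → ZMod 2) :
    (bitError a * A) x y = A (x + a) y := by
  rw [Matrix.mul_apply, Finset.sum_eq_single (x + a)]
  · rw [bitError_apply, bits_add_add_cancel, if_pos rfl, one_mul]
  · intro z _ hz
    rw [bitError_apply, if_neg, zero_mul]
    rintro rfl
    exact hz (bits_add_add_cancel _ _).symm
  · simp

theorem bitError_mulVec (a : Fin N → ZMod 2) (ψ : QState N) (x : Fin N → ZMod 2) :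
    (bitError a).mulVec ψ x = ψ (x + a) := by
  rw [Matrix.mulVec, dotProduct, Finset.sum_eq_single (x + a)]
  · rw [bitError_apply, bits_add_add_cancel, if_pos rfl, one_mul]
  · intro z _ hz
    rw [bitError_apply, if_neg, zero_mul]
    rintro rfl
    exact hz (bits_add_add_cancel _ _).symm
  · simp

theorem bitError_mul_bitError (a b : Fin N → ZMod 2) :
    bitError a * bitError b = bitError (a + b) := by
  ext x y
  rw [bitError_mul, bitError_apply, bitError_apply]
  have h : x + a = y + b ↔ x = y + (a + b) := by
    constructor
    · intro h
      rw [← bits_add_add_cancel x a, h]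
      abel
    · rintro rfl
      rw [show y + (a + b) + a = y + b + a + a by abel, bits_add_add_cancel]
  simp only [h]

theorem bitError_zero : bitError (0 : Fin N → ZMod 2) = 1 := by
  ext x y
  rw [bitError_apply, add_zero, Matrix.one_apply]

end ErrorOperators

/-! ### The code space of a union of cosets, and its projection. -/

section CodeSpace

variable {N : ℕ} (S : Set (Fin N → ZMod 2)) (U : Submodule (ZMod 2) (Fin N → ZMod 2))

open Classical in
/-- The projection onto the states that are supported on `S` and invariant under translation by
`U`, provided that `S` is a union of cosets of `U`. -/
noncomputable def codeProj : QOp N :=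
  Matrix.of fun x y => if x ∈ S ∧ x + y ∈ U then (Nat.card U : ℂ)⁻¹ else 0

/-- The space of states that are supported on `S` and invariant under translation by `U`. -/
noncomputable def codeSpace : Submodule ℂ (QState N) := LinearMap.range (codeProj S U).mulVecLin

open Classical in
theorem codeProj_apply (x y : Fin N → ZMod 2) :
    codeProj S U x y = if x ∈ S ∧ x + y ∈ U then (Nat.card U : ℂ)⁻¹ else 0 := rfl

variable {S U}

theorem codeProj_eq_zero_left {x : Fin N → ZMod 2} (hx : x ∉ S) (y : Fin N → ZMod 2) :
    codeProj S U x y = 0 := by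
  rw [codeProj_apply, if_neg fun h => hx h.1]

open Classical in
theorem codeProj_comm (hS : ∀ x ∈ S, ∀ u ∈ U, x + u ∈ S) (x y : Fin N → ZMod 2) :
    codeProj S U x y = codeProj S U y x := by
  have h : ∀ x y : Fin N → ZMod 2, x ∈ S ∧ x + y ∈ U → y ∈ S ∧ y + x ∈ U := by
    rintro x y ⟨h1, h2⟩
    refine ⟨?_, by rwa [add_comm]⟩
    have := hS x h1 _ h2
    rwa [add_comm x y, add_comm, bits_add_add_cancel] at this
  have hiff : x ∈ S ∧ x + y ∈ U ↔ y ∈ S ∧ y + x ∈ U := ⟨h x y, h y x⟩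
  rw [codeProj_apply, codeProj_apply]
  exact if_congr hiff rfl rfl

theorem codeProj_eq_zero_right (hS : ∀ x ∈ S, ∀ u ∈ U, x + u ∈ S) {y : Fin N → ZMod 2}
    (hy : y ∉ S) (x : Fin N → ZMod 2) : codeProj S U x y = 0 := by
  rw [codeProj_comm hS, codeProj_eq_zero_left hy]

open Classical in
theorem codeProj_add_right {u : Fin N → ZMod 2} (hu : u ∈ U) (x y : Fin N → ZMod 2) :
    codeProj S U x (y + u) = codeProj S U x y := by
  rw [codeProj_apply, codeProj_apply, ← add_assoc]
  exact if_congr (and_congr_right fun _ => U.add_mem_iff_left hu) rfl rfl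

theorem codeProj_conjTranspose (hS : ∀ x ∈ S, ∀ u ∈ U, x + u ∈ S) :
    (codeProj S U).conjTranspose = codeProj S U := by
  ext x y
  rw [Matrix.conjTranspose_apply, codeProj_comm hS y x, codeProj_apply]
  split_ifs <;> simp

open Classical in
theorem card_translate (x : Fin N → ZMod 2) :
    (Finset.univ.filter fun y => x + y ∈ U).card = Nat.card U := by
  rw [← Fintype.card_subtype, ← Nat.card_eq_fintype_card]
  exact Nat.card_congr ((Equiv.addLeft x).subtypeEquiv fun y => Iff.rfl)

theorem codeProj_mul_self (hS : ∀ x ∈ S, ∀ u ∈ U, x + u ∈ S) :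
    codeProj S U * codeProj S U = codeProj S U := by
  classical
  ext x z
  have key : ∀ y, codeProj S U x y * codeProj S U y z =
      if x + y ∈ U then (Nat.card U : ℂ)⁻¹ * codeProj S U x z else 0 := by
    intro y
    by_cases hxy : x + y ∈ U
    · rw [if_pos hxy]
      have h1 : codeProj S U y z = codeProj S U x z := by
        rw [codeProj_comm hS y z, codeProj_comm hS x z, ← codeProj_add_right hxy z x, ← add_assoc,
          bits_add_self, zero_add]
      rw [h1]
      by_cases hx : x ∈ S
      · rw [codeProj_apply S U x y, if_pos ⟨hx, hxy⟩]
      · rw [codeProj_eq_zero_left hx z, mul_zero, mul_zero]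
    · rw [if_neg hxy, codeProj_apply, if_neg fun h => hxy h.2, zero_mul]
  rw [Matrix.mul_apply, Finset.sum_congr rfl fun y _ => key y, ← Finset.sum_filter,
    Finset.sum_const, card_translate, nsmul_eq_mul, ← mul_assoc, mul_inv_cancel₀, one_mul]
  exact Nat.cast_ne_zero.mpr Nat.card_pos.ne'

theorem codeProj_mulVec (hS : ∀ x ∈ S, ∀ u ∈ U, x + u ∈ S) {ψ : QState N}
    (hψ : ψ ∈ codeSpace S U) : (codeProj S U).mulVec ψ = ψ := by
  obtain ⟨φ, rfl⟩ := hψ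
  rw [Matrix.mulVecLin_apply, Matrix.mulVec_mulVec, codeProj_mul_self hS]

theorem eq_zero_of_mem_codeSpace {ψ : QState N} (hψ : ψ ∈ codeSpace S U) {y : Fin N → ZMod 2}
    (hy : y ∉ S) : ψ y = 0 := by
  obtain ⟨φ, rfl⟩ := hψ
  rw [Matrix.mulVecLin_apply, Matrix.mulVec, dotProduct]
  refine Finset.sum_eq_zero fun z _ => ?_
  rw [codeProj_eq_zero_left hy, zero_mul]

/-- The rank of a projection is its trace, and each x in S contributes 1/|U| to the diagonal. -/
theorem finrank_codeSpace (hS : ∀ x ∈ S, ∀ u ∈ U, x + u ∈ S) :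
    Module.finrank ℂ (codeSpace S U) * Nat.card U = Nat.card S := by
  classical
  have hproj : LinearMap.IsProj (codeSpace S U) (codeProj S U).mulVecLin :=
    ⟨fun x => ⟨x, rfl⟩, fun x hx => codeProj_mulVec hS hx⟩
  have h := hproj.trace
  have htr : LinearMap.trace ℂ (QState N) (codeProj S U).mulVecLin = (codeProj S U).trace := by
    rw [← Matrix.toLin'_apply', Matrix.trace_toLin'_eq]
  rw [htr, Matrix.trace] at h
  have hdiag : ∀ x, (codeProj S U).diag x = if x ∈ S then (Nat.card U : ℂ)⁻¹ else 0 := by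
    intro x
    rw [Matrix.diag_apply, codeProj_apply, bits_add_self]
    simp
  rw [Finset.sum_congr rfl fun x _ => hdiag x, ← Finset.sum_filter, Finset.sum_const,
    nsmul_eq_mul] at h
  have hcard : (Finset.univ.filter fun x => x ∈ S).card = Nat.card S := by
    rw [← Fintype.card_subtype, ← Nat.card_eq_fintype_card]
  have h0 : (Nat.card U : ℂ) ≠ 0 := Nat.cast_ne_zero.mpr Nat.card_pos.ne'
  rw [hcard, mul_inv_eq_iff_eq_mul₀ h0] at h
  exact_mod_cast h.symm

theorem codeProj_bitError_codeProj (hS : ∀ x ∈ S, ∀ u ∈ U, x + u ∈ S) {e : Fin N → ZMod 2}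
    (he : ∀ x ∈ S, x + e ∉ S) (d d' : (Fin N → ZMod 2) → ℂ) :
    codeProj S U * (Matrix.diagonal d * (bitError e * (Matrix.diagonal d' * codeProj S U))) = 0 := by
  ext x z
  rw [Matrix.mul_apply, Matrix.zero_apply]
  refine Finset.sum_eq_zero fun y _ => ?_
  rw [Matrix.diagonal_mul, bitError_mul, Matrix.diagonal_mul]
  by_cases hy : y ∈ S
  · rw [codeProj_eq_zero_left (he y hy), mul_zero, mul_zero, mul_zero]
  · rw [codeProj_eq_zero_right hS hy, zero_mul]

theorem codeProj_diagonal_codeProj (hS : ∀ x ∈ S, ∀ u ∈ U, x + u ∈ S) {d : (Fin N → ZMod 2) → ℂ}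
    {u : Fin N → ZMod 2} (hu : u ∈ U) (hd : ∀ y, d (y + u) = -d y) :
    codeProj S U * (Matrix.diagonal d * codeProj S U) = 0 := by
  ext x z
  rw [Matrix.mul_apply, Matrix.zero_apply]
  simp only [Matrix.diagonal_mul]
  -- Substituting y + u for y fixes both projection entries and negates d.
  have h : ∑ y, codeProj S U x y * (d y * codeProj S U y z) =
      -∑ y, codeProj S U x y * (d y * codeProj S U y z) := by
    rw [← Finset.sum_neg_distrib,
      ← Equiv.sum_comp (Equiv.addRight u) fun y => codeProj S U x y * (d y * codeProj S U y z)]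
    refine Finset.sum_congr rfl fun y _ => ?_
    rw [Equiv.coe_addRight, codeProj_add_right hu, hd, codeProj_comm hS (y + u),
      codeProj_add_right hu, codeProj_comm hS z]
    ring
  exact self_eq_neg.mp h

end CodeSpace

/-! ### Recovery from orthogonal error spaces. -/

section Recovery

variable {N : ℕ} {ι : Type*} [Fintype ι] [DecidableEq ι]

/-- If the operators `F i` map the range of the orthogonal projection `P` isometrically onto mutually
orthogonal subspaces, and every error acts on this range as some `F i`, then the range of `P`
corrects these errors. -/
theorem correctsErrors_of_orthogonal {tp tb : ℕ} {P : QOp N} (hP : P.conjTranspose = P)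
    (hPP : P * P = P) (F : ι → QOp N)
    (hF : ∀ i j, P * (F i).conjTranspose * (F j * P) = if i = j then P else 0)
    (hE : ∀ E : QOp N, IsPauliError tp tb E → ∃ i, E * P = F i * P) :
    CorrectsErrors tp tb (LinearMap.range P.mulVecLin) := by
  -- Each `some i` undoes `F i`; `none` is the projection onto the complement of all error spaces,
  -- which completes the channel and annihilates every corrupted code state.
  let R : Option ι → QOp N := fun o =>
    o.elim (1 - ∑ i, F i * P * (P * (F i).conjTranspose)) fun i => P * (F i).conjTranspose
  have hR : ∀ i, (P * (F i).conjTranspose).conjTranspose = F i * P := by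
    intro i
    rw [Matrix.conjTranspose_mul, Matrix.conjTranspose_conjTranspose, hP]
  have hsome : ∀ i j, R (some i) * (F j * P) = if i = j then P else 0 := hF
  have hproj : ∀ j, (∑ i, F i * P * (P * (F i).conjTranspose)) * (F j * P) = F j * P := by
    intro j
    rw [Finset.sum_mul, Finset.sum_eq_single j]
    · rw [Matrix.mul_assoc, hF, if_pos rfl, Matrix.mul_assoc, hPP]
    · intro i _ hij
      rw [Matrix.mul_assoc, hF, if_neg hij, Matrix.mul_zero]
    · simp
  have hnone : ∀ j, R none * (F j * P) = 0 := by
    intro j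
    change (1 - ∑ i, F i * P * (P * (F i).conjTranspose)) * (F j * P) = 0
    rw [Matrix.sub_mul, hproj, Matrix.one_mul, sub_self]
  have hsum : ∑ o, (R o).conjTranspose * R o = 1 := by
    rw [Fintype.sum_option]
    have h1 : (R none).conjTranspose = R none := by
      change (1 - ∑ i, F i * P * (P * (F i).conjTranspose)).conjTranspose = 1 - _
      rw [Matrix.conjTranspose_sub, Matrix.conjTranspose_one, Matrix.conjTranspose_sum]
      congr 1
      refine Finset.sum_congr rfl fun i _ => ?_
      rw [Matrix.conjTranspose_mul, hR, ← hR i, Matrix.conjTranspose_conjTranspose]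
    have h2 : R none * R none = R none := by
      have : R none * ∑ i, F i * P * (P * (F i).conjTranspose) = 0 := by
        rw [Finset.mul_sum]
        refine Finset.sum_eq_zero fun i _ => ?_
        rw [← Matrix.mul_assoc, hnone, Matrix.zero_mul]
      calc R none * R none = R none * 1 - R none * ∑ i, F i * P * (P * (F i).conjTranspose) :=
            Matrix.mul_sub _ _ _
        _ = R none := by rw [this, Matrix.mul_one, sub_zero]
    have h3 : ∀ i, (R (some i)).conjTranspose * R (some i) =
        F i * P * (P * (F i).conjTranspose) := by
      intro i
      change (P * (F i).conjTranspose).conjTranspose * (P * (F i).conjTranspose) = _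
      rw [hR]
    rw [h1, h2, Finset.sum_congr rfl fun i _ => h3 i]
    exact sub_add_cancel _ _
  have hchan : ∀ E : QOp N, IsPauliError tp tb E → ∀ ψ ∈ LinearMap.range P.mulVecLin,
      ∑ o, Matrix.vecMulVec ((R o * E).mulVec ψ) (star ((R o * E).mulVec ψ)) =
        Matrix.vecMulVec ψ (star ψ) := by
    rintro E hE' ψ ⟨φ, rfl⟩
    obtain ⟨j, hj⟩ := hE E hE'
    have hval : ∀ o, (R o * E).mulVec (P.mulVecLin φ) = (R o * (F j * P)).mulVec φ := by
      intro o
      rw [Matrix.mulVecLin_apply, Matrix.mulVec_mulVec, Matrix.mul_assoc, hj]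
    rw [Finset.sum_congr rfl fun o _ => by rw [hval o], Fintype.sum_option, hnone,
      Finset.sum_eq_single j]
    · rw [hsome, if_pos rfl, Matrix.zero_mulVec, Matrix.zero_vecMulVec, zero_add,
        Matrix.mulVecLin_apply]
    · intro i _ hij
      rw [hsome, if_neg hij, Matrix.zero_mulVec, Matrix.zero_vecMulVec]
    · simp
  refine ⟨Fintype.card (Option ι), fun r => R ((Fintype.equivFin (Option ι)).symm r), ?_, ?_⟩
  · rw [← hsum]
    exact (Fintype.equivFin (Option ι)).symm.sum_comp fun o => (R o).conjTranspose * R o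
  · intro E hE' ψ hψ
    rw [← hchan E hE' ψ hψ]
    exact (Fintype.equivFin (Option ι)).symm.sum_comp fun o =>
      Matrix.vecMulVec ((R o * E).mulVec ψ) (star ((R o * E).mulVec ψ))

end Recovery

/-! ### Error correction and synchronization from combinatorial conditions. -/

section CodeSpaceProperties

variable {N : ℕ} {S : Set (Fin N → ZMod 2)} {U : Submodule (ZMod 2) (Fin N → ZMod 2)}

/-- Error correction with the code space of `S` and `U`: bit errors are corrected if they move `S` to
disjoint sets, phase errors if they are represented on `S` by functions `d k` with values `±1` whose
pairwise products change sign under some translation by `U`. -/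
theorem correctsErrors_codeSpace (hS : ∀ x ∈ S, ∀ u ∈ U, x + u ∈ S) {tp tb : ℕ}
    (hbit : ∀ a b : Fin N → ZMod 2, hammingNorm a ≤ tb → hammingNorm b ≤ tb → a ≠ b →
      ∀ x ∈ S, x + (a + b) ∉ S)
    {κ : Type*} [Fintype κ] (d : κ → (Fin N → ZMod 2) → ℂ) (hd : ∀ k y, star (d k y) = d k y)
    (hdd : ∀ k y, d k y * d k y = 1)
    (hne : ∀ k l, k ≠ l → ∃ u ∈ U, ∀ y, d k (y + u) * d l (y + u) = -(d k y * d l y))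
    (hphase : ∀ b : Fin N → ZMod 2, hammingNorm b ≤ tp →
      ∃ k, ∀ y ∈ S, signChar (b ⬝ᵥ y) = d k y) :
    CorrectsErrors tp tb (codeSpace S U) := by
  classical
  refine correctsErrors_of_orthogonal (codeProj_conjTranspose hS) (codeProj_mul_self hS)
    (ι := {a : Fin N → ZMod 2 // hammingNorm a ≤ tb} × κ)
    (fun i => bitError i.1.1 * Matrix.diagonal (d i.2)) ?_ ?_
  · rintro ⟨a, k⟩ ⟨b, l⟩
    have hdk : star (d k) = d k := funext (hd k)
    have hstep : codeProj S U * (bitError a.1 * Matrix.diagonal (d k)).conjTranspose *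
        (bitError b.1 * Matrix.diagonal (d l) * codeProj S U) =
        codeProj S U * (Matrix.diagonal (d k) * (bitError (a.1 + b.1) *
          (Matrix.diagonal (d l) * codeProj S U))) := by
      rw [Matrix.conjTranspose_mul, bitError_conjTranspose, Matrix.diagonal_conjTranspose, hdk,
        ← bitError_mul_bitError]
      simp only [Matrix.mul_assoc]
    change codeProj S U * (bitError a.1 * Matrix.diagonal (d k)).conjTranspose *
        (bitError b.1 * Matrix.diagonal (d l) * codeProj S U) = _
    rw [hstep]
    by_cases hab : a = b
    · subst hab
      rw [bits_add_self, bitError_zero, Matrix.one_mul, ← Matrix.mul_assoc (Matrix.diagonal _),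
        Matrix.diagonal_mul_diagonal]
      by_cases hkl : k = l
      · subst hkl
        simp only [hdd, if_pos, Matrix.diagonal_one, Matrix.one_mul, codeProj_mul_self hS]
      · obtain ⟨u, hu, h⟩ := hne k l hkl
        rw [if_neg (by simpa using hkl), codeProj_diagonal_codeProj hS hu h]
    · rw [if_neg fun h => hab (congrArg Prod.fst h), codeProj_bitError_codeProj hS]
      exact hbit _ _ a.2 b.2 fun h => hab (Subtype.ext h)
  · rintro _ ⟨a, b, ha, hb, rfl⟩
    obtain ⟨k, hk⟩ := hphase b hb
    refine ⟨(⟨a, ha⟩, k), ?_⟩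
    change _ = bitError a * Matrix.diagonal (d k) * _
    rw [Matrix.mul_assoc, Matrix.mul_assoc]
    congr 1
    -- Rows of the projection outside S vanish, so it is enough that the two phase functions agree
    -- on S.
    ext x y
    rw [phaseError_eq, Matrix.diagonal_mul, Matrix.diagonal_mul]
    by_cases hx : x ∈ S
    · rw [hk x hx]
    · rw [codeProj_eq_zero_left hx, mul_zero, mul_zero]

theorem extend_comp_self {A B C : Type*} (w : A → B) (x : B → C) :
    Function.extend w (x ∘ w) x = x := by
  classical
  funext b
  rw [Function.extend_def]
  split_ifs with h
  · exact congrArg x h.choose_spec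
  · rfl

/-- Misalignment can be read off without disturbing the state if it is a function of the bit string
seen through the window. -/
theorem identifiesMisalignment_codeSpace {al ar tp tb : ℕ}
    (f : (Fin N → ZMod 2) → Fin (al + ar + 1))
    (hf : ∀ a : Fin N → ZMod 2, hammingNorm a ≤ tb → ∀ x : Fin (al + N + ar) → ZMod 2,
      x ∘ window al ar N (aligned al ar) + a ∈ S → ∀ s, f (x ∘ window al ar N s) = s) :
    IdentifiesMisalignment al ar tp tb (codeSpace S U) := by
  refine ⟨fun s => Matrix.diagonal fun y => if f y = s then 1 else 0, ?_, ?_, ?_, ?_, ?_⟩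
  · intro s
    refine Matrix.isHermitian_diagonal_of_self_adjoint _ (funext fun y => ?_)
    rw [Pi.star_apply]
    split_ifs <;> simp
  · intro s
    rw [Matrix.diagonal_mul_diagonal]
    simp
  · intro s t hst
    rw [Matrix.diagonal_mul_diagonal]
    rw [← Matrix.diagonal_zero]
    congr 1
    funext y
    split_ifs with h1 h2
    · exact absurd (h1.symm.trans h2) hst
    all_goals simp
  · ext x y
    rw [Matrix.sum_apply]
    by_cases hxy : x = y
    · subst hxy
      simp
    · simp [hxy]
  · rintro _ ⟨a, b, ha, hb, rfl⟩ Ψ hΨ s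
    -- Phase errors only rescale amplitudes, so the block part of any string in the support of Ψ
    -- lies in S shifted by the bit error a.
    have hsupp : ∀ x : Fin (al + N + ar) → ZMod 2, Ψ x ≠ 0 → f (x ∘ window al ar N s) = s := by
      intro x hx
      refine hf a ha x ?_ s
      by_contra hS
      obtain ⟨ψ, hψ, h⟩ := hΨ x
      have hval := congrFun h (x ∘ window al ar N (aligned al ar))

      rw [extend_comp_self, Matrix.mulVecLin_apply, ← Matrix.mulVec_mulVec, bitError_mulVec,
        phaseError_eq, Matrix.mulVec_diagonal, eq_zero_of_mem_codeSpace hψ hS, mul_zero] at hval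
      exact hx hval.symm
    funext x
    have hrow : ∀ y, Matrix.diagonal (fun y => if f y = s then (1 : ℂ) else 0)
        (x ∘ window al ar N s) y * Ψ (Function.extend (window al ar N s) y x) =
        if y = x ∘ window al ar N s then Ψ x else 0 := by
      intro y
      by_cases hy : y = x ∘ window al ar N s
      · rw [if_pos hy, hy, Matrix.diagonal_apply_eq, extend_comp_self]
        by_cases hx : Ψ x = 0
        · rw [hx, mul_zero]
        · rw [if_pos (hsupp x hx), one_mul]
      · rw [if_neg hy, Matrix.diagonal_apply_ne' _ hy, zero_mul]
    exact (Finset.sum_congr rfl fun y _ => hrow y).trans (by simp)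

end CodeSpaceProperties

/-! ### Periodic extension of words and its transpose. -/

section PeriodicExtension

variable {m N : ℕ}

/-- The periodic extension of a word of length `m` to length `N`. -/
def periodicExt (m N : ℕ) [NeZero m] : (Fin m → ZMod 2) →ₗ[ZMod 2] (Fin N → ZMod 2) :=
  LinearMap.funLeft (ZMod 2) (ZMod 2) fun p : Fin N => ⟨p % m, Nat.mod_lt _ (NeZero.pos m)⟩

theorem periodicExt_apply [NeZero m] (c : Fin m → ZMod 2) (p : Fin N) :
    periodicExt m N c p = c ⟨p % m, Nat.mod_lt _ (NeZero.pos m)⟩ := rfl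

theorem periodicExt_comp_castLE [NeZero m] (h : m ≤ N) (c : Fin m → ZMod 2) :
    periodicExt m N c ∘ Fin.castLE h = c := by
  funext i
  rw [Function.comp_apply, periodicExt_apply]
  congr 1
  exact Fin.ext (Nat.mod_eq_of_lt i.2)

theorem periodicExt_injective [NeZero m] (h : m ≤ N) : Function.Injective (periodicExt m N) := by
  intro a b hab
  rw [← periodicExt_comp_castLE h a, hab, periodicExt_comp_castLE]

/-- The word of length `m` that has the same inner products with words of length `m` as `b` has with
their periodic extensions. -/
def fold (m : ℕ) [NeZero m] (b : Fin N → ZMod 2) : Fin m → ZMod 2 := fun i =>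
  ∑ p ∈ (Finset.univ : Finset (Fin N)).filter fun p : Fin N => (p : ℕ) % m = i, b p

theorem dotProduct_periodicExt [NeZero m] (b : Fin N → ZMod 2) (c : Fin m → ZMod 2) :
    b ⬝ᵥ periodicExt m N c = fold m b ⬝ᵥ c := by
  simp only [dotProduct, fold, Finset.sum_mul, Finset.sum_filter]
  rw [Finset.sum_comm]
  refine Finset.sum_congr rfl fun p _ => ?_
  rw [Finset.sum_eq_single ⟨p % m, Nat.mod_lt _ (NeZero.pos m)⟩]
  · rw [if_pos rfl, periodicExt_apply]
  · intro i _ hi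
    rw [if_neg fun h => hi (Fin.ext h.symm), zero_mul]
  · simp

/-- A nonzero folded entry needs a nonzero entry of b in its residue class. -/
theorem hammingNorm_fold_le [NeZero m] (b : Fin N → ZMod 2) :
    hammingNorm (fold m b) ≤ hammingNorm b := by
  refine le_trans (Finset.card_le_card fun i hi => ?_)
    (Finset.card_image_le (f := fun p : Fin N =>
      (⟨p % m, Nat.mod_lt _ (NeZero.pos m)⟩ : Fin m)))
  rw [Finset.mem_filter] at hi
  obtain ⟨p, hp, hb⟩ := Finset.exists_ne_zero_of_sum_ne_zero hi.2
  rw [Finset.mem_filter] at hp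
  exact Finset.mem_image.mpr ⟨p, by simpa using hb, Fin.ext hp.2⟩

theorem hammingNorm_comp_le (e : Fin N → ZMod 2) {w : Fin m → Fin N} (hw : Function.Injective w) :
    hammingNorm (e ∘ w) ≤ hammingNorm e := by
  refine Finset.card_le_card_of_injOn w (fun i hi => ?_) hw.injOn
  simpa using hi

end PeriodicExtension

/-! ### The synchronizable code of a coset of a dual-containing code. -/

section QSC

variable {m : ℕ} [NeZero m] {W : Submodule (ZMod 2) (Fin m → ZMod 2)}

/-- The bit strings of the code states: periodic extensions of the words in the coset `w + W`. -/
def cosetStrings (N : ℕ) (w : Fin m → ZMod 2) (W : Submodule (ZMod 2) (Fin m → ZMod 2)) :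
    Set (Fin N → ZMod 2) :=
  (fun c => periodicExt m N (w + c)) '' (W : Set (Fin m → ZMod 2))

theorem cosetStrings_add_mem {N : ℕ} {w : Fin m → ZMod 2} (hW : dualCode W ≤ W) :
    ∀ x ∈ cosetStrings N w W, ∀ u ∈ (dualCode W).map (periodicExt m N),
      x + u ∈ cosetStrings N w W := by
  rintro _ ⟨c, hc, rfl⟩ _ ⟨u, hu, rfl⟩
  exact ⟨c + u, W.add_mem hc (hW hu), by simp only [map_add, add_assoc]⟩

theorem finrank_codeSpace_cosetStrings {N k : ℕ} (hmN : m ≤ N) {w : Fin m → ZMod 2}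
    (hW : dualCode W ≤ W)
    (hk : k + Module.finrank (ZMod 2) (dualCode W) = Module.finrank (ZMod 2) W) :
    Module.finrank ℂ (codeSpace (cosetStrings N w W) ((dualCode W).map (periodicExt m N))) =
      2 ^ k := by
  have h := finrank_codeSpace (cosetStrings_add_mem (N := N) (w := w) hW)
  have hU : Nat.card ((dualCode W).map (periodicExt m N)) =
      2 ^ Module.finrank (ZMod 2) (dualCode W) := by
    rw [← natCard_eq_two_pow]
    exact Nat.card_image_of_injective (periodicExt_injective hmN) (dualCode W : Set (Fin m → ZMod 2))
  have hS : Nat.card (cosetStrings N w W) = 2 ^ Module.finrank (ZMod 2) W := by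
    rw [← natCard_eq_two_pow]
    refine Nat.card_image_of_injective (fun a b hab => ?_) (W : Set (Fin m → ZMod 2))
    exact add_left_cancel (periodicExt_injective hmN hab)
  rw [hU, hS, ← hk, pow_add] at h
  exact Nat.eq_of_mul_eq_mul_right (by positivity) h

/-- Phase errors with the same folding act identically on the code strings, so they are classified
by their foldings; bit errors are compared on the first m positions. -/
theorem correctsErrors_cosetStrings {N d₁ d₂ : ℕ} (hmN : m ≤ N) {w : Fin m → ZMod 2}
    (hW : dualCode W ≤ W) (hd₁ : d₁ ≤ minDist W) (hd₂ : d₂ ≤ minDist W) :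
    CorrectsErrors ((d₁ - 1) / 2) ((d₂ - 1) / 2)
      (codeSpace (cosetStrings N w W) ((dualCode W).map (periodicExt m N))) := by
  classical
  refine correctsErrors_codeSpace (cosetStrings_add_mem hW) ?_
    (κ := {b : Fin m → ZMod 2 // hammingNorm b ≤ (d₁ - 1) / 2})
    (fun b y => signChar (b.1 ⬝ᵥ (y ∘ Fin.castLE hmN))) (fun b y => star_signChar _)
    (fun b y => signChar_mul_self _) ?_ ?_
  · rintro a b ha hb hab _ ⟨c, hc, rfl⟩ ⟨c', hc', h⟩
    have hinj : Function.Injective (Fin.castLE hmN) := Fin.castLE_injective hmN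
    have hcomp := congrArg (fun y => y ∘ Fin.castLE hmN) h
    have hcomp' : w + c' = w + c + (a ∘ Fin.castLE hmN + b ∘ Fin.castLE hmN) := by
      have e1 := periodicExt_comp_castLE hmN (w + c')
      have e2 := periodicExt_comp_castLE hmN (w + c)
      rw [← e1, ← e2]
      exact hcomp
    have hcc : c' + c ∈ W := W.add_mem hc' hc
    have hceq : c' = c := by
      refine eq_of_add_eq_add hd₂ hcc ((hammingNorm_comp_le b hinj).trans hb)
        ((hammingNorm_comp_le a hinj).trans ha) ?_
      have := add_left_cancel (hcomp'.trans (add_assoc w c _))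
      rw [this, ← add_assoc, bits_add_add_cancel]
    subst hceq
    -- Once the first m bits agree, the whole extended strings agree, so a and b also coincide
    -- beyond position m.
    exact hab (bits_eq_of_add_eq_zero (left_eq_add.mp h))
  · rintro ⟨b, hb⟩ ⟨b', hb'⟩ hne
    -- The sum is nonzero and lighter than the minimum distance; a dual word with inner product 1
    -- with it supplies the sign change.
    have hmem : b + b' ∉ W := fun h =>
      hne (Subtype.ext (add_mem_of_hammingNorm_le hd₁ hb hb' h))
    obtain ⟨u, hu, hone⟩ := exists_dotProduct_eq_one hmem
    refine ⟨periodicExt m N u, ⟨u, hu, rfl⟩, fun y => ?_⟩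
    have hy : (y + periodicExt m N u) ∘ Fin.castLE hmN = y ∘ Fin.castLE hmN + u :=
      congrArg (y ∘ Fin.castLE hmN + ·) (periodicExt_comp_castLE hmN u)
    simp only [← AddChar.map_add_eq_mul, hy, ← add_dotProduct]
    rw [dotProduct_add, hone, AddChar.map_add_eq_mul, signChar_one, mul_neg_one]
  · intro b hb
    refine ⟨⟨fold m b, (hammingNorm_fold_le b).trans hb⟩, ?_⟩
    rintro _ ⟨c, -, rfl⟩
    simp only
    rw [periodicExt_comp_castLE, dotProduct_periodicExt]

/-- If the cosets of cyclic shifts of `w` are far apart, then misalignment is identified by decoding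
the `m` bits in the middle of the window. -/
theorem identifiesMisalignment_cosetStrings {al ar tp tb : ℕ} {w : Fin m → ZMod 2}
    (hsep : ∀ s t : Fin (al + ar + 1), ∀ c ∈ W, ∀ c' ∈ W, ∀ e e' : Fin m → ZMod 2,
      hammingNorm e ≤ tb → hammingNorm e' ≤ tb →
      cyclicShift s (w + c) + e = cyclicShift t (w + c') + e' → s = t)
    (U : Submodule (ZMod 2) (Fin (m + al + ar) → ZMod 2)) :
    IdentifiesMisalignment al ar tp tb (codeSpace (cosetStrings (m + al + ar) w W) U) := by
  classical
  -- The block starts at position al of the segment, so in the window at s these bits are the block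
  -- positions s, …, s + m - 1. They stay inside the block because s ≤ al + ar, so the neighbouring
  -- qubits are never read.
  let μ : Fin m → Fin (m + al + ar) := fun i => ⟨al + i, by omega⟩
  let A : Fin (al + ar + 1) → (Fin (m + al + ar) → ZMod 2) → Prop := fun s y =>
    ∃ c ∈ W, ∃ e : Fin m → ZMod 2, hammingNorm e ≤ tb ∧ y ∘ μ = cyclicShift s (w + c) + e
  have huniq : ∀ s t y, A s y → A t y → s = t := by
    rintro s t y ⟨c, hc, e, he, h⟩ ⟨c', hc', e', he', h'⟩
    exact hsep s t c hc c' hc' e e' he he' (h.symm.trans h')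
  -- The default outcome is arbitrary: it concerns only strings that fit no offset.
  let f : (Fin (m + al + ar) → ZMod 2) → Fin (al + ar + 1) := fun y =>
    if h : ∃ s, A s y then h.choose else aligned al ar
  have hf : ∀ s y, A s y → f y = s := by
    intro s y hs
    have h : ∃ s, A s y := ⟨s, hs⟩
    simp only [f, dif_pos h]
    exact huniq _ _ _ h.choose_spec hs
  refine identifiesMisalignment_codeSpace f ?_
  rintro a ha x ⟨c, hc, hx⟩ s
  refine hf s _ ⟨c, hc, fun i => a ⟨s + i, by omega⟩, ?_, ?_⟩
  · refine (hammingNorm_comp_le a (w := fun i : Fin m => ⟨s + i, by omega⟩) ?_).trans ha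
    intro i j hij
    have := congrArg Fin.val hij
    simp only at this
    exact Fin.ext (by omega)
  · have hx' : x ∘ window al ar (m + al + ar) (aligned al ar) =
        periodicExt m (m + al + ar) (w + c) + a := by
      rw [← bits_add_add_cancel (x ∘ _) a, ← hx]
    funext i
    have hi := congrFun hx' ⟨s + i, by omega⟩
    rw [Pi.add_apply, periodicExt_apply] at hi
    rw [Pi.add_apply, cyclicShift, ← hi]
    simp only [Function.comp_apply, window, aligned, μ]
    congr 1
    exact Fin.ext (by simp only; omega)

end QSC

/-! ### Distinct offsets give distinguishable noisy words. -/

section Separation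

variable {m : ℕ} {L : Type*} [Field L] [Algebra (ZMod 2) L] {α : L} {M : ℕ → (ZMod 2)[X]}
  {I T T' : Finset ℕ}

theorem cyclicCode_prod_le (hT' : T' ⊆ T) :
    cyclicCode m (∏ i ∈ T, M i) ≤ cyclicCode m (∏ i ∈ T', M i) := fun _ h =>
  (Finset.prod_dvd_prod_of_subset _ _ _ hT').trans h

/-- Noisy words in the cosets of two cyclic shifts of the generator of the larger code differ, unless
the shifts agree modulo the order of the quotient of the generators. -/
theorem cyclicShift_eq_of_noisy_eq (hm : Odd m) (hα : IsPrimitiveRoot α m)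
    (hM : ∀ i, M i = minpoly (ZMod 2) (α ^ i))
    (hfac : X ^ m - 1 = (X - 1) * ∏ i ∈ I, (M i * (M i).reverse)) (hT' : T' ⊆ T) (hT : T ⊆ I)
    {w : Fin m → ZMod 2} (hw : wordPoly w = ∏ i ∈ T', M i) {d : ℕ}
    (hd : d ≤ minDist (cyclicCode m (∏ i ∈ T', M i)))
    {s t : ℕ} (hs : s < polyOrder (∏ i ∈ T \ T', M i)) (ht : t < polyOrder (∏ i ∈ T \ T', M i))
    {c c' e e' : Fin m → ZMod 2} (hc : c ∈ cyclicCode m (∏ i ∈ T, M i))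
    (hc' : c' ∈ cyclicCode m (∏ i ∈ T, M i)) (he : hammingNorm e ≤ (d - 1) / 2)
    (he' : hammingNorm e' ≤ (d - 1) / 2)
    (h : cyclicShift s (w + c) + e = cyclicShift t (w + c') + e') : s = t := by
  have hT'I := hT'.trans hT
  have hle := cyclicCode_prod_le (m := m) (M := M) hT'
  have hwD : w ∈ cyclicCode m (∏ i ∈ T', M i) := by rw [mem_cyclicCode, hw]
  have hmem : ∀ (r : ℕ), ∀ c ∈ cyclicCode m (∏ i ∈ T, M i),
      cyclicShift r (w + c) ∈ cyclicCode m (∏ i ∈ T', M i) := fun r c hc =>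
    cyclicShift_mem hm hα hM hfac hT'I (Submodule.add_mem _ hwD (hle hc)) r
  -- Both shifted words lie in the larger code, whose distance removes the noise.
  have heq := eq_of_add_eq_add hd (Submodule.add_mem _ (hmem s c hc) (hmem t c' hc')) he he' h
  have hroot : ∀ i ∈ T \ T', (α ^ i) ^ s = (α ^ i) ^ t := by
    intro i hi
    -- At these roots c vanishes and only w contributes, so the value does not depend on c and the
    -- shift appears only as the factor (α^i)^r.
    have hval : ∀ (r : ℕ), ∀ c ∈ cyclicCode m (∏ i ∈ T, M i),
        (α ^ i) ^ r * aeval (α ^ i) (wordPoly (cyclicShift r (w + c))) =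
          aeval (α ^ i) (∏ j ∈ T', M j) := by
      intro r c hc
      rw [mem_cyclicCode_prod hm hM hfac hT] at hc
      rw [pow_mul_aeval_cyclicShift (root_pow_eq_one hα i), wordPoly_add, map_add,
        hc i (Finset.sdiff_subset hi), add_zero, hw]
    have h0 := aeval_prod_ne_zero hm hM hfac hT' hT hi
    have h1 := hval s c hc
    have h2 := hval t c' hc'
    rw [← heq] at h2
    have h3 : aeval (α ^ i) (wordPoly (cyclicShift s (w + c))) ≠ 0 := by
      intro hz
      rw [hz, mul_zero] at h1
      exact h0 h1.symm
    exact mul_right_cancel₀ h3 (h1.trans h2.symm)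
  have hα0 : α ≠ 0 := hα.ne_zero hm.pos.ne'
  have hsub : T \ T' ⊆ I := Finset.sdiff_subset.trans hT
  have main : ∀ s t : ℕ, s ≤ t → t < polyOrder (∏ i ∈ T \ T', M i) →
      (∀ i ∈ T \ T', (α ^ i) ^ s = (α ^ i) ^ t) → s = t := by
    intro s t hst ht hroot
    have hdvd : polyOrder (∏ i ∈ T \ T', M i) ∣ t - s := by
      refine polyOrder_dvd hm hM hfac hsub fun i hi => ?_
      have hpow := hroot i hi
      rw [← Nat.add_sub_cancel' hst, pow_add] at hpow
      exact (left_eq_mul₀ (pow_ne_zero _ (pow_ne_zero _ hα0))).mp hpow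
    have := Nat.eq_zero_of_dvd_of_lt hdvd (by omega)
    omega
  rcases le_total s t with hst | hst
  · exact main s t hst ht hroot
  · exact (main t s hst hs fun i hi => (hroot i hi).symm).symm

end Separation

theorem mainTheorem5 (m : ℕ) (hm : 1 < m) (hodd : Odd m)
    (hp : ∀ p : ℕ, p.Prime → p ∣ m → p ≡ 7 [MOD 8])
    {L : Type*} [Field L] [Algebra (ZMod 2) L] (α : L) (hα : IsPrimitiveRoot α m)
    (M : ℕ → (ZMod 2)[X]) (hM : ∀ i, M i = minpoly (ZMod 2) (α ^ i))
    (I : Finset ℕ) (hI : ∀ i ∈ I, M i ≠ (M i).reverse)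
    (hfac : X ^ m - 1 = (X - 1) * ∏ i ∈ I, (M i * (M i).reverse))
    (T T' : Finset ℕ) (hT' : T' ⊆ T) (hT : T ⊆ I)
    (n d₁ d₂ : ℕ)
    (hn : n = polyOrder (∏ i ∈ T \ T', M i))
    (hd₁ : d₁ = minDist (cyclicCode m (∏ i ∈ T, M i)))
    (hd₂ : d₂ = minDist (cyclicCode m (∏ i ∈ T', M i))) :
    n ∣ m ∧ d₂ ≤ d₁ ∧
    (∃ k : ℕ, k + 2 * ∑ i ∈ T, (M i).natDegree = m ∧
      ∀ al ar : ℕ, al + ar < n →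
        ∃ Q : Submodule ℂ (QState (m + al + ar)),
          IsQSC al ar k ((d₁ - 1) / 2) ((d₂ - 1) / 2) Q) ∧
    (Nat.gcd m (T.gcd id) = 1 → 1 ≤ (d₁ - 1) / 2) ∧
    (Nat.gcd m (T'.gcd id) = 1 → 1 ≤ (d₂ - 1) / 2) := by
  have : NeZero m := ⟨by omega⟩
  have hT'I := hT'.trans hT
  have hsub : T \ T' ⊆ I := Finset.sdiff_subset.trans hT
  have hne := cyclicCode_prod_ne_bot hodd hα hM hI hfac hT
  have hd : d₂ ≤ d₁ := by
    rw [hd₁, hd₂]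
    exact minDist_antitone hne (cyclicCode_prod_le hT')
  refine ⟨?_, hd, ?_, ?_, ?_⟩
  · rw [hn]
    exact polyOrder_dvd hodd hM hfac hsub fun i _ => root_pow_eq_one hα i
  · have hdeg := natDegree_prod_lt hodd hfac hT
    have hmonic : ∀ i ∈ T, (M i).Monic := fun i _ => by
      rw [hM]
      exact minpoly.monic (IsIntegral.of_pow hodd.pos
        (by rw [root_pow_eq_one hα i]; exact isIntegral_one))
    have hfin := finrank_cyclicCode (monic_prod_of_monic T M hmonic) hdeg.le
    rw [natDegree_prod_of_monic T M hmonic] at hfin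
    have hdual := dualCode_le_cyclicCode hodd hα hM hfac hT
    have hle := Submodule.finrank_mono hdual
    have hsum := finrank_dualCode (cyclicCode m (∏ i ∈ T, M i))
    obtain ⟨k, hk⟩ := Nat.exists_eq_add_of_le' hle
    -- Here k = dim C - dim C^⊥, with dim C^⊥ the degree of the generator and dim C = m minus that
    -- degree.
    refine ⟨k, by omega, fun al ar hal => ?_⟩
    have hmN : m ≤ m + al + ar := by omega
    obtain ⟨w, hw⟩ : ∃ w : Fin m → ZMod 2, wordPoly w = ∏ i ∈ T', M i :=
      ⟨_, wordPoly_coeff (natDegree_prod_lt hodd hfac hT'I)⟩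
    refine ⟨codeSpace (cosetStrings (m + al + ar) w (cyclicCode m (∏ i ∈ T, M i)))
      ((dualCode (cyclicCode m (∏ i ∈ T, M i))).map (periodicExt m (m + al + ar))),
      finrank_codeSpace_cosetStrings hmN hdual hk.symm,
      identifiesMisalignment_cosetStrings (fun s t c hc c' hc' e e' he he' h => ?_) _,
      -- On the realigned block both error types are corrected through C, whose distance d₁ is at
      -- least d₂; the bit-error bound d₂ is what synchronization requires.
      correctsErrors_cosetStrings hmN hdual hd₁.le (hd.trans hd₁.le)⟩
    rw [hn] at hal
    exact Fin.ext (cyclicShift_eq_of_noisy_eq hodd hα hM hfac hT' hT hw hd₂.le (by omega)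
      (by omega) hc hc' he he' h)
  · intro hg
    have := three_le_minDist hm.ne' hodd hα hM hI hfac hT hg
    omega
  · intro hg
    have := three_le_minDist hm.ne' hodd hα hM hI hfac hT'I hg
    omega
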